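/- Let $N\ge 1$ and $m\ge 1$ be integers, and let $x_{n,k},y_{n,k}$ ($1\le n\le N$, $1\le k\le m$) be $2Nm$ mutually independent real Gaussian random variables with mean $0$ and variance $1/2$. For real numbers $\rho_2,\dots,\rho_N$ put $$g_{1,k}=x_{1,k}+\jmath\, y_{1,k},\qquad g_{n,k}=\sqrt{1-\rho_n^2}\,x_{n,k}+\rho_n x_{1,k}+\jmath\left(\sqrt{1-\rho_n^2}\,y_{n,k}+\rho_n y_{1,k}\right)\quad(2\le n\le N),$$ let $\hat h_n=\sum_{k=1}^m|g_{n,k}|^2$ be the estimated gain of port $n$ (so that the $\sqrt{\hat h_n}$ are correlated Nakagami-$m$ envelopes), and let $\hat h=\max\{\hat h_1,\dots,\hat h_N\}$. For $a>0$ and $b\ge 0$ let $$Q_m(a,b)=\int_b^\infty t\left(\frac ta\right)^{m-1}e^{-(t^2+a^2)/2}\,I_{m-1}(at)\,dt$$ be the generalized Marcum $Q$-function, where $I_{m-1}$ is the modified Bessel function of the first kind, and let $Q_m(0,b)=\Gamma(m,b^2/2)/\Gamma(m)$ be its limit as $a\to0$, where $\Gamma(\cdot,\cdot)$ is the upper incomplete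 gamma function. (i) If $|\rho_n|<1$ for $n=2,\dots,N$, then the cumulative distribution function of $\hat h$ is $F_{\hat h}(x)=0$ for $x<0$ and $$F_{\hat h}(x)=\frac1{\Gamma(m)}\int_0^x e^{-z}z^{m-1}\prod_{n=2}^N\phi_n(z,x)\,dz\qquad(x\ge 0),$$ where $$\phi_n(z,x)=1-Q_m\left(\sqrt{\frac{2z\rho_n^2}{1-\rho_n^2}},\sqrt{\frac{2x}{1-\rho_n^2}}\right).$$ (ii) In particular, if $\rho_n=J_0(2\pi d_n/\lambda)$, where $J_0$ is the Bessel function of the first kind of order $0$, $\lambda>0$ is the wavelength and $d_n>0$ is the displacement of port $n$ from port $1$ ($n=2,\dots,N$), then $|\rho_n|<1$ for $n=2,\dots,N$ and the formula in (i) holds. -/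

import Mathlib

open MeasureTheory ProbabilityTheory

namespace FluidAntenna

noncomputable section

/-- Bessel function of the first kind of integer order `n`, by its power series. -/
def besselJ (n : ℕ) (x : ℝ) : ℝ :=
  ∑' k : ℕ, (-1 : ℝ) ^ k / ((k.factorial : ℝ) * ((k + n).factorial : ℝ)) * (x / 2) ^ (2 * k + n)

/-- Modified Bessel function of the first kind of integer order `n`, by its power series. -/
def besselI (n : ℕ) (x : ℝ) : ℝ :=
  ∑' k : ℕ, 1 / ((k.factorial : ℝ) * ((k + n).factorial : ℝ)) * (x / 2) ^ (2 * k + n)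

/-- Upper incomplete gamma function `Γ(m, b) = ∫_b^∞ t^(m-1) e^(-t) dt` of integer order `m ≥ 1`. -/
def upperGamma (m : ℕ) (b : ℝ) : ℝ :=
  ∫ t in Set.Ioi b, t ^ (m - 1) * Real.exp (-t)

/-- Generalized Marcum Q-function of integer order `m ≥ 1`, for `a, b ≥ 0`:
`Q_m(a, b) = ∫_b^∞ t (t/a)^(m-1) exp(-(t² + a²)/2) I_{m-1}(a t) dt`,
where at `a = 0` the integral formula is read as its limit `Γ(m, b²/2) / Γ(m)`. -/
def marcumQ (m : ℕ) (a b : ℝ) : ℝ :=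
  if a = 0 then upperGamma m (b ^ 2 / 2) / Real.Gamma m
  else ∫ t in Set.Ioi b,
    t * (t / a) ^ (m - 1) * Real.exp (-(t ^ 2 + a ^ 2) / 2) * besselI (m - 1) (a * t)

/-- `φ(z, x) = 1 - Q_m(√(2 z ρ² / (1 - ρ²)), √(2 x / (1 - ρ²)))`. -/
def phi (m : ℕ) (ρ z x : ℝ) : ℝ :=
  1 - marcumQ m (Real.sqrt (2 * z * ρ ^ 2 / (1 - ρ ^ 2))) (Real.sqrt (2 * x / (1 - ρ ^ 2)))

/-- Correlation coefficient `J₀(2 π d / lam)` of a port at displacement `d` from the reference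
port, for wavelength `lam`. -/
def portCorrelation (lam d : ℝ) : ℝ := besselJ 0 (2 * Real.pi * (d / lam))

variable {Ω : Type*} {N m : ℕ} [NeZero N]

/-- The complex Gaussian variable `g_{n,k}` (with `σ = 1`). The ports are indexed by `Fin N`
and the reference port is `0`; the value of `ρ` at the reference port is irrelevant. -/
def channel (ρ : Fin N → ℝ) (X Y : Fin N → Fin m → Ω → ℝ) (n : Fin N) (k : Fin m) (ω : Ω) : ℂ :=
  if n = 0 then
    (X 0 k ω : ℂ) + Complex.I * (Y 0 k ω : ℂ)
  else
    ((Real.sqrt (1 - ρ n ^ 2) * X n k ω + ρ n * X 0 k ω : ℝ) : ℂ)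
      + Complex.I * ((Real.sqrt (1 - ρ n ^ 2) * Y n k ω + ρ n * Y 0 k ω : ℝ) : ℂ)

/-- The gain of port `n`: `∑ₖ |g_{n,k}|²`. -/
def portGain (ρ : Fin N → ℝ) (X Y : Fin N → Fin m → Ω → ℝ) (n : Fin N) (ω : Ω) : ℝ :=
  ∑ k : Fin m, ‖channel ρ X Y n k ω‖ ^ 2

/-- The gain of the best port. -/
def bestGain (ρ : Fin N → ℝ) (X Y : Fin N → Fin m → Ω → ℝ) (ω : Ω) : ℝ :=
  Finset.univ.sup' ⟨0, Finset.mem_univ _⟩ (fun n : Fin N => portGain ρ X Y n ω)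

end

end FluidAntenna

namespace FluidAntenna

noncomputable section

/-! Condition on the reference port, i.e. on its vector `u` of `2 * m` real Gaussians. Given `u`,
the other ports are independent, and the gain of port `n` is `1 - ρ²` times a sum of squares `∑ (w i
+ c i)²` with `c = ρ u / √(1 - ρ²)`. The law of such a sum depends on `c` only through `lam = ∑ (c
i)²`. The conditional probability that every gain is at most `x` is therefore a product of functions
of `z = ∑ (u i)²`, restricted to `z ≤ x`, and integrating against the law of `z`, a gamma law of
shape `m`, gives the formula.

It remains to see that each factor is `phi`. Characteristic functions identify the law of the
shifted sum of squares with a Poisson mixture of gamma laws (`map_sum_sq_add_pi_gaussianReal`).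
Expanding the Bessel function inside the Marcum integral produces the same mixture term by term
(`marcumQ_eq_noncentralGamma_real`).

For (ii), Bessel's integral writes `J₀(x)` as an average of cosines that are not all `1` or all
`-1`, so `|J₀(x)| < 1` for `x > 0`. -/

/-! ### Gamma laws and their characteristic functions. -/

open Complex in
theorem norm_pow_mul_cexp_neg_one_sub_mul_I (t : ℝ) (n : ℕ) {x : ℝ} (hx : 0 ≤ x) :
    ‖(x : ℂ) ^ n * cexp (-(1 - t * I) * x)‖ = x ^ n * Real.exp (-x) := by
  rw [norm_mul, norm_pow, Complex.norm_exp, Complex.norm_of_nonneg hx]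
  simp

theorem integrableOn_pow_mul_exp_neg (n : ℕ) :
    IntegrableOn (fun x : ℝ => x ^ n * Real.exp (-x)) (Set.Ioi 0) := by
  have h := Real.GammaIntegral_convergent (s := n + 1) (by positivity)
  refine h.congr_fun (fun x _ => ?_) measurableSet_Ioi
  simp [mul_comm]

open Complex in
theorem integrableOn_pow_mul_cexp_neg_one_sub_mul_I (t : ℝ) (n : ℕ) :
    IntegrableOn (fun x : ℝ => (x : ℂ) ^ n * cexp (-(1 - t * I) * x)) (Set.Ioi 0) := by
  refine (integrableOn_pow_mul_exp_neg n).mono' (by fun_prop) ?_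
  filter_upwards [ae_restrict_mem measurableSet_Ioi] with x hx
  exact (norm_pow_mul_cexp_neg_one_sub_mul_I t n (le_of_lt hx)).le

open Complex in
/-- Euler's integral for `n!` on the vertical line through `1`. -/
theorem integral_pow_mul_cexp_neg_one_sub_mul_I (t : ℝ) (n : ℕ) :
    ∫ x : ℝ in Set.Ioi 0, (x : ℂ) ^ n * cexp (-(1 - t * I) * x) =
      n.factorial / (1 - t * I) ^ (n + 1) := by
  have hne : (1 - t * I : ℂ) ≠ 0 := fun h => by simpa using congrArg re h
  induction n with
  | zero =>
    simp only [pow_zero, one_mul, Nat.factorial_zero, Nat.cast_one, zero_add, pow_one]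
    rw [integral_exp_mul_complex_Ioi (by simp)]
    simp only [ofReal_zero, mul_zero, Complex.exp_zero]
    rw [div_neg, neg_div, neg_neg]
  | succ n ih =>
    -- Integration by parts: this function vanishes at `0` and at infinity, so the integral of its
    -- derivative is zero, which is the recursion in `n`.
    have hderiv : ∀ x ∈ Set.Ioi (0 : ℝ),
        HasDerivAt (fun x : ℝ => (x : ℂ) ^ (n + 1) * cexp (-(1 - t * I) * x))
          ((n + 1) * ((x : ℂ) ^ n * cexp (-(1 - t * I) * x)) -
            (1 - t * I) * ((x : ℂ) ^ (n + 1) * cexp (-(1 - t * I) * x))) x := by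
      intro x _
      have h₁ : HasDerivAt (fun x : ℂ => x ^ (n + 1) * cexp (-(1 - t * I) * x)) _ (x : ℂ) :=
        (hasDerivAt_pow (n + 1) (x : ℂ)).mul ((hasDerivAt_id (x : ℂ)).const_mul (-(1 - t * I))).cexp
      convert h₁.comp_ofReal using 1
      simp only [id, Nat.add_sub_cancel]
      push_cast
      ring
    have hlim : Filter.Tendsto (fun x : ℝ => (x : ℂ) ^ (n + 1) * cexp (-(1 - t * I) * x))
        Filter.atTop (nhds 0) := by
      rw [tendsto_zero_iff_norm_tendsto_zero]
      refine (Real.tendsto_pow_mul_exp_neg_atTop_nhds_zero (n + 1)).congr' ?_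
      filter_upwards [Filter.eventually_ge_atTop 0] with x hx
      exact (norm_pow_mul_cexp_neg_one_sub_mul_I t (n + 1) hx).symm
    have hi₁ := (integrableOn_pow_mul_cexp_neg_one_sub_mul_I t n).const_mul ((n : ℂ) + 1)
    have hi₂ := (integrableOn_pow_mul_cexp_neg_one_sub_mul_I t (n + 1)).const_mul (1 - t * I)
    have h := integral_Ioi_of_hasDerivAt_of_tendsto (by fun_prop) hderiv (hi₁.sub hi₂) hlim
    rw [integral_sub hi₁ hi₂, integral_const_mul, integral_const_mul, ih] at h
    simp only [ofReal_zero, ne_eq, Nat.add_eq_zero_iff, one_ne_zero, and_false, not_false_eq_true,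
      zero_pow, zero_mul, sub_zero] at h
    rw [Nat.factorial_succ, eq_div_iff (pow_ne_zero _ hne), pow_succ]
    have h' := sub_eq_zero.mp h
    rw [mul_comm _ (1 - t * I : ℂ), ← mul_assoc, mul_comm _ (1 - t * I : ℂ), ← h']
    push_cast
    field_simp

/-- On `[0, ∞)` the gamma density of integer shape and unit rate is `x ^ (m - 1) e ^ (-x) / Γ(m)`. -/
theorem gammaPDFReal_natCast_one {m : ℕ} (hm : 1 ≤ m) {x : ℝ} (hx : 0 ≤ x) :
    gammaPDFReal m 1 x = (Real.Gamma m)⁻¹ * (x ^ (m - 1) * Real.exp (-x)) := by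
  rw [gammaPDFReal, if_pos hx, ← Nat.cast_one, ← Nat.cast_sub hm, Real.rpow_natCast]
  simp [mul_assoc]

open Complex in
/-- The characteristic function of the gamma distribution of integer shape and unit rate. -/
theorem charFun_gammaMeasure_one {m : ℕ} (hm : 1 ≤ m) (t : ℝ) :
    charFun (gammaMeasure m 1) t = ((1 - t * I) ^ m)⁻¹ := by
  have hm0 : (0 : ℝ) < m := by exact_mod_cast hm
  rw [charFun_apply_real, gammaMeasure,
    integral_withDensity_eq_integral_toReal_smul (by unfold gammaPDF; fun_prop)
      (ae_of_all _ fun x => by simp [gammaPDF])]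
  have hsupp : ∀ x, x ∉ Set.Ici (0 : ℝ) →
      (gammaPDF m 1 x).toReal • cexp (t * x * I) = 0 := fun x hx => by
    rw [gammaPDF_of_neg (by simpa using hx)]; simp
  rw [← setIntegral_eq_integral_of_forall_compl_eq_zero hsupp, integral_Ici_eq_integral_Ioi]
  have hcongr : ∀ x ∈ Set.Ioi (0 : ℝ), (gammaPDF m 1 x).toReal • cexp (t * x * I) =
      ((Real.Gamma m)⁻¹ : ℝ) * ((x : ℂ) ^ (m - 1) * cexp (-(1 - t * I) * x)) := by
    intro x hx
    rw [gammaPDF, ENNReal.toReal_ofReal (gammaPDFReal_nonneg hm0 one_pos x),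
      gammaPDFReal_natCast_one hm (le_of_lt hx), real_smul]
    push_cast
    rw [mul_assoc, mul_assoc, ← Complex.exp_add]
    congr 3
    ring
  rw [setIntegral_congr_fun measurableSet_Ioi hcongr, integral_const_mul,
    integral_pow_mul_cexp_neg_one_sub_mul_I]
  obtain ⟨n, rfl⟩ : ∃ n, m = n + 1 := ⟨m - 1, by omega⟩
  have hn : (n.factorial : ℂ) ≠ 0 := by exact_mod_cast n.factorial_ne_zero
  rw [Nat.cast_succ, Real.Gamma_nat_eq_factorial, Nat.add_sub_cancel]
  push_cast
  field_simp

/-! ### The noncentral gamma law and shifted Gaussian sums of squares. -/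

/-- The law of `∑ᵢ (gᵢ + cᵢ)²` for `2 m` independent centred Gaussians `gᵢ` of variance `1 / 2` and
`lam = ∑ᵢ cᵢ²`: a Poisson mixture of gamma distributions. -/
def noncentralGamma (m : ℕ) (lam : ℝ) : Measure ℝ :=
  Measure.sum fun k : ℕ =>
    ENNReal.ofReal (Real.exp (-lam) * lam ^ k / k.factorial) • gammaMeasure ((m + k : ℕ) : ℝ) 1

theorem hasSum_poissonWeight (lam : ℝ) :
    HasSum (fun k : ℕ => Real.exp (-lam) * lam ^ k / k.factorial) 1 := by
  have h := (NormedSpace.expSeries_div_hasSum_exp (𝔸 := ℝ) lam).mul_left (Real.exp (-lam))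
  rw [← Real.exp_eq_exp_ℝ, ← Real.exp_add] at h
  simpa [mul_div_assoc] using h

theorem poissonWeight_nonneg {lam : ℝ} (hlam : 0 ≤ lam) (k : ℕ) :
    0 ≤ Real.exp (-lam) * lam ^ k / k.factorial := by positivity

theorem isProbabilityMeasure_gammaMeasure_natCast_add {m : ℕ} (hm : 1 ≤ m) (k : ℕ) :
    IsProbabilityMeasure (gammaMeasure ((m + k : ℕ) : ℝ) 1) :=
  isProbabilityMeasure_gammaMeasure (by exact_mod_cast (by omega : 0 < m + k)) one_pos

theorem isProbabilityMeasure_noncentralGamma {m : ℕ} (hm : 1 ≤ m) {lam : ℝ} (hlam : 0 ≤ lam) :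
    IsProbabilityMeasure (noncentralGamma m lam) where
  measure_univ := by
    have := isProbabilityMeasure_gammaMeasure_natCast_add hm
    simp only [noncentralGamma, Measure.sum_apply _ MeasurableSet.univ, Measure.smul_apply,
      measure_univ, smul_eq_mul, mul_one]
    rw [← ENNReal.ofReal_tsum_of_nonneg (poissonWeight_nonneg hlam)
      (hasSum_poissonWeight lam).summable, (hasSum_poissonWeight lam).tsum_eq, ENNReal.ofReal_one]

-- Raising the shape by `k` multiplies the gamma characteristic function by `(1 - t * I)⁻ᵏ`, so the
-- Poisson weights sum to the exponential series of `lam / (1 - t * I)`.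
open Complex in
theorem charFun_noncentralGamma {m : ℕ} (hm : 1 ≤ m) {lam : ℝ} (hlam : 0 ≤ lam) (t : ℝ) :
    charFun (noncentralGamma m lam) t =
      ((1 - t * I) ^ m)⁻¹ * cexp (t * I * lam / (1 - t * I)) := by
  have := isProbabilityMeasure_noncentralGamma hm hlam
  have hne : (1 - t * I : ℂ) ≠ 0 := fun h => by simpa using congrArg re h
  have hint : Integrable (fun x : ℝ => cexp (t * x * I)) (noncentralGamma m lam) := by
    refine Integrable.of_bound (C := 1) (by fun_prop) (ae_of_all _ fun x => ?_)
    rw [← ofReal_mul, norm_exp_ofReal_mul_I]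
  have h₁ := hasSum_integral_measure hint
  rw [charFun_apply_real]
  refine h₁.unique ?_
  have hterm : ∀ k : ℕ, ∫ x : ℝ, cexp (t * x * I)
      ∂(ENNReal.ofReal (Real.exp (-lam) * lam ^ k / k.factorial) •
        gammaMeasure ((m + k : ℕ) : ℝ) 1) =
      ((1 - t * I) ^ m)⁻¹ * cexp (-lam) * ((lam / (1 - t * I)) ^ k / k.factorial) := by
    intro k
    rw [integral_smul_measure, ENNReal.toReal_ofReal (poissonWeight_nonneg hlam k),
      ← charFun_apply_real, charFun_gammaMeasure_one (by omega), real_smul]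
    push_cast
    rw [pow_add, div_pow]
    field_simp
  refine HasSum.congr_fun ?_ hterm
  have h₂ := (NormedSpace.expSeries_div_hasSum_exp (𝔸 := ℂ) (lam / (1 - t * I))).mul_left
    (((1 - t * I) ^ m)⁻¹ * cexp (-lam))
  rw [← Complex.exp_eq_exp_ℂ, mul_assoc, ← Complex.exp_add] at h₂
  have hexp : t * I * lam / (1 - t * I) = -lam + lam / (1 - t * I) := by
    field_simp
    ring
  rwa [hexp]

-- Completing the square; the Gaussian converges because `1 - t * I` has real part `1`. The square
-- root of `π / (1 - t * I)` is left as a complex power, since it will only occur to the even power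
-- `2 * m`, where the branch is irrelevant.
open Complex in
theorem integral_cexp_sq_gaussianReal (t c : ℝ) :
    ∫ x, cexp (t * I * (x + c) ^ 2) ∂gaussianReal 0 (1 / 2) =
      (((√Real.pi)⁻¹ : ℝ) * (Real.pi / (1 - t * I)) ^ (1 / 2 : ℂ)) *
        cexp (t * I * c ^ 2 / (1 - t * I)) := by
  have hne : (1 - t * I : ℂ) ≠ 0 := fun h => by simpa using congrArg re h
  rw [integral_gaussianReal_eq_integral_smul (by norm_num)]
  have hcongr : ∀ x : ℝ, gaussianPDFReal 0 (1 / 2) x • cexp (t * I * (x + c) ^ 2) =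
      ((√Real.pi)⁻¹ : ℝ) *
        cexp (-(1 - t * I) * x ^ 2 + 2 * t * I * c * x + t * I * c ^ 2) := by
    intro x
    rw [gaussianPDFReal, real_smul]
    push_cast
    rw [mul_assoc, ← Complex.exp_add]
    congr 2
    · rw [mul_comm (2 : ℝ), mul_assoc]
      norm_num
    · ring
  simp_rw [hcongr]
  rw [integral_const_mul, integral_cexp_quadratic (by simp)]
  have hexp : t * I * c ^ 2 - (2 * t * I * c) ^ 2 / (4 * -(1 - t * I)) =
      t * I * c ^ 2 / (1 - t * I) := by
    field_simp
    ring
  rw [neg_neg, hexp, ← mul_assoc]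

/-- A sum of squares of shifted independent Gaussians has a noncentral gamma law, which depends on
the shifts through the sum of their squares only. -/
theorem map_sum_sq_add_pi_gaussianReal {ι : Type*} [Fintype ι] {m : ℕ} (hm : 1 ≤ m)
    (hι : Fintype.card ι = 2 * m) (c : ι → ℝ) :
    (Measure.pi fun _ : ι => gaussianReal 0 (1 / 2)).map (fun w => ∑ i, (w i + c i) ^ 2) =
      noncentralGamma m (∑ i, c i ^ 2) := by
  have hlam : 0 ≤ ∑ i, c i ^ 2 := Finset.sum_nonneg fun i _ => sq_nonneg _
  have := isProbabilityMeasure_noncentralGamma hm hlam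
  have hmeas : Measurable (fun w : ι → ℝ => ∑ i, (w i + c i) ^ 2) := by fun_prop
  have := Measure.isProbabilityMeasure_map
    (μ := Measure.pi fun _ : ι => gaussianReal 0 (1 / 2)) hmeas.aemeasurable
  refine Measure.ext_of_charFun (funext fun t => ?_)
  rw [charFun_noncentralGamma hm hlam, charFun_apply_real,
    integral_map hmeas.aemeasurable (by fun_prop)]
  have hcongr : ∀ w : ι → ℝ, Complex.exp (t * (∑ i, (w i + c i) ^ 2 : ℝ) * Complex.I) =
      ∏ i, Complex.exp (t * Complex.I * ((w i : ℂ) + c i) ^ 2) := by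
    intro w
    rw [← Complex.exp_sum, ← Finset.mul_sum]
    push_cast
    congr 1
    ring
  simp_rw [hcongr]
  rw [integral_fintype_prod_eq_prod (𝕜 := ℂ)
    (f := fun i (x : ℝ) => Complex.exp (t * Complex.I * ((x : ℂ) + c i) ^ 2))]
  simp_rw [integral_cexp_sq_gaussianReal]
  rw [Finset.prod_mul_distrib, Finset.prod_const, Finset.card_univ, hι, ← Complex.exp_sum, pow_mul,
    mul_pow, one_div, Complex.cpow_ofNat_inv_pow, ← Finset.sum_div, ← Finset.mul_sum]
  have hpi : (((√Real.pi)⁻¹ : ℝ) : ℂ) ^ 2 = (Real.pi : ℂ)⁻¹ := by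
    rw [← Complex.ofReal_pow, inv_pow, Real.sq_sqrt Real.pi_pos.le, Complex.ofReal_inv]
  have hpi0 : (Real.pi : ℂ) ≠ 0 := by exact_mod_cast Real.pi_ne_zero
  rw [hpi, ← mul_div_assoc, inv_mul_cancel₀ hpi0, one_div, inv_pow]
  push_cast
  rfl

/-! ### The Marcum function as a noncentral gamma tail. -/

theorem image_sq_div_two_Ioi {b : ℝ} (hb : 0 ≤ b) :
    (fun t : ℝ => t ^ 2 / 2) '' Set.Ioi b = Set.Ioi (b ^ 2 / 2) := by
  ext h
  simp only [Set.mem_image, Set.mem_Ioi]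
  constructor
  · rintro ⟨t, ht, rfl⟩
    gcongr
  · intro hh
    refine ⟨√(2 * h), (Real.lt_sqrt hb).mpr (by linarith), ?_⟩
    rw [Real.sq_sqrt (by nlinarith [sq_nonneg b])]
    ring

theorem injOn_sq_div_two_Ioi {b : ℝ} (hb : 0 ≤ b) :
    Set.InjOn (fun t : ℝ => t ^ 2 / 2) (Set.Ioi b) := by
  intro s hs t ht hst
  have hs : b < s := hs
  have ht : b < t := ht
  have hst : s ^ 2 / 2 = t ^ 2 / 2 := hst
  exact (sq_eq_sq₀ (by linarith) (by linarith)).mp (by linarith)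

theorem hasDerivWithinAt_sq_div_two (s : Set ℝ) (t : ℝ) :
    HasDerivWithinAt (fun t : ℝ => t ^ 2 / 2) t s t := by
  refine ((hasDerivAt_pow 2 t).div_const 2).hasDerivWithinAt.congr_deriv ?_
  push_cast
  ring

theorem integrableOn_mul_comp_sq_div_two {b : ℝ} (hb : 0 ≤ b) {g : ℝ → ℝ}
    (hg : IntegrableOn g (Set.Ioi (b ^ 2 / 2))) :
    IntegrableOn (fun t => t * g (t ^ 2 / 2)) (Set.Ioi b) := by
  rw [← image_sq_div_two_Ioi hb, integrableOn_image_iff_integrableOn_abs_deriv_smul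
    measurableSet_Ioi (fun t _ => hasDerivWithinAt_sq_div_two _ t) (injOn_sq_div_two_Ioi hb)] at hg
  refine hg.congr_fun (fun t ht => ?_) measurableSet_Ioi
  simp only [smul_eq_mul]
  rw [abs_of_nonneg (hb.trans (le_of_lt ht))]

theorem integral_mul_comp_sq_div_two {b : ℝ} (hb : 0 ≤ b) (g : ℝ → ℝ) :
    ∫ t in Set.Ioi b, t * g (t ^ 2 / 2) = ∫ h in Set.Ioi (b ^ 2 / 2), g h := by
  rw [← image_sq_div_two_Ioi hb, integral_image_eq_integral_abs_deriv_smul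
    measurableSet_Ioi (fun t _ => hasDerivWithinAt_sq_div_two _ t) (injOn_sq_div_two_Ioi hb)]
  refine setIntegral_congr_fun measurableSet_Ioi (fun t ht => ?_)
  simp only [smul_eq_mul]
  rw [abs_of_nonneg (hb.trans (le_of_lt ht))]

theorem gammaMeasure_real_Ioi {m : ℕ} (hm : 1 ≤ m) {c : ℝ} (hc : 0 ≤ c) :
    (gammaMeasure m 1).real (Set.Ioi c) = upperGamma m c / Real.Gamma m := by
  have hm0 : (0 : ℝ) < m := by exact_mod_cast hm
  rw [gammaMeasure, measureReal_def, withDensity_apply _ measurableSet_Ioi]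
  simp only [gammaPDF]
  rw [← integral_eq_lintegral_of_nonneg_ae
      (ae_of_all _ fun x => gammaPDFReal_nonneg hm0 one_pos x) (by fun_prop),
    setIntegral_congr_fun measurableSet_Ioi
      (fun x hx => gammaPDFReal_natCast_one hm (hc.trans (le_of_lt hx))),
    integral_const_mul, upperGamma]
  ring

theorem hasSum_noncentralGamma_real {m : ℕ} (hm : 1 ≤ m) {lam : ℝ} (hlam : 0 ≤ lam) {s : Set ℝ}
    (hs : MeasurableSet s) :
    HasSum (fun k : ℕ => Real.exp (-lam) * lam ^ k / k.factorial *
      (gammaMeasure ((m + k : ℕ) : ℝ) 1).real s) ((noncentralGamma m lam).real s) := by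
  have := isProbabilityMeasure_gammaMeasure_natCast_add hm
  have hsum : Summable (fun k : ℕ => Real.exp (-lam) * lam ^ k / k.factorial *
      (gammaMeasure ((m + k : ℕ) : ℝ) 1).real s) :=
    (hasSum_poissonWeight lam).summable.of_nonneg_of_le
      (fun k => mul_nonneg (poissonWeight_nonneg hlam k) measureReal_nonneg)
      (fun k => mul_le_of_le_one_right (poissonWeight_nonneg hlam k) measureReal_le_one)
  have heq : (noncentralGamma m lam).real s = ∑' k : ℕ, Real.exp (-lam) * lam ^ k / k.factorial *
      (gammaMeasure ((m + k : ℕ) : ℝ) 1).real s := by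
    rw [measureReal_def, noncentralGamma, Measure.sum_apply _ hs, ENNReal.tsum_toReal_eq]
    · refine tsum_congr fun k => ?_
      rw [Measure.smul_apply, smul_eq_mul, ENNReal.toReal_mul,
        ENNReal.toReal_ofReal (poissonWeight_nonneg hlam k), measureReal_def]
    · intro k
      exact ENNReal.mul_ne_top ENNReal.ofReal_ne_top (measure_ne_top _ _)
  rw [heq]
  exact hsum.hasSum

theorem noncentralGamma_zero (m : ℕ) : noncentralGamma m 0 = gammaMeasure m 1 := by
  refine Measure.ext fun s hs => ?_
  rw [noncentralGamma, Measure.sum_apply _ hs, tsum_eq_single 0]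
  · simp
  · intro k hk
    simp [hk]

/-- Under `h = t² / 2`, `dh = t dt`, the `k`-th Bessel term becomes the `k`-th Poisson weight of
parameter `a² / 2` times the gamma density of shape `n + 1 + k`. -/
theorem integrand_marcumQ_eq (n k : ℕ) {a : ℝ} (ha : a ≠ 0) (t : ℝ) :
    t * (t / a) ^ n * Real.exp (-(t ^ 2 + a ^ 2) / 2) *
        (1 / ((k.factorial : ℝ) * ((k + n).factorial : ℝ)) * (a * t / 2) ^ (2 * k + n)) =
      Real.exp (-(a ^ 2 / 2)) * (a ^ 2 / 2) ^ k / k.factorial * ((n + k).factorial : ℝ)⁻¹ *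
        (t * ((t ^ 2 / 2) ^ (n + k) * Real.exp (-(t ^ 2 / 2)))) := by
  have hexp : Real.exp (-(t ^ 2 + a ^ 2) / 2) =
      Real.exp (-(a ^ 2 / 2)) * Real.exp (-(t ^ 2 / 2)) := by
    rw [← Real.exp_add]; ring_nf
  have h₁ : (t / a) ^ n * (a * t / 2) ^ n = (t ^ 2 / 2) ^ n := by
    rw [← mul_pow]
    congr 1
    field_simp
  have h₂ : (a * t / 2) ^ (2 * k) = (a ^ 2 / 2) ^ k * (t ^ 2 / 2) ^ k := by
    rw [pow_mul, ← mul_pow]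
    congr 1
    ring
  rw [hexp, pow_add (a * t / 2), pow_add (t ^ 2 / 2), h₂, ← h₁, add_comm k n]
  field_simp

/-- The Marcum `Q`-function is the tail of the noncentral gamma distribution. -/
theorem marcumQ_eq_noncentralGamma_real {m : ℕ} (hm : 1 ≤ m) (a : ℝ) {b : ℝ} (hb : 0 ≤ b) :
    marcumQ m a b = (noncentralGamma m (a ^ 2 / 2)).real (Set.Ioi (b ^ 2 / 2)) := by
  rw [marcumQ]
  split_ifs with ha
  · subst ha
    rw [zero_pow two_ne_zero, zero_div, noncentralGamma_zero m,
      gammaMeasure_real_Ioi hm (by positivity)]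
  have hlam : 0 ≤ a ^ 2 / 2 := by positivity
  obtain ⟨n, rfl⟩ : ∃ n, m = n + 1 := ⟨m - 1, by omega⟩
  rw [Nat.add_sub_cancel]
  let F : ℕ → ℝ → ℝ := fun k t =>
    Real.exp (-(a ^ 2 / 2)) * (a ^ 2 / 2) ^ k / k.factorial * ((n + k).factorial : ℝ)⁻¹ *
      (t * ((t ^ 2 / 2) ^ (n + k) * Real.exp (-(t ^ 2 / 2))))
  have hF : ∀ t, t * (t / a) ^ n * Real.exp (-(t ^ 2 + a ^ 2) / 2) * besselI n (a * t) =
      ∑' k, F k t := fun t => by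
    rw [besselI, ← tsum_mul_left]
    exact tsum_congr fun k => integrand_marcumQ_eq n k ha t
  have hint : ∀ k, IntegrableOn (F k) (Set.Ioi b) := fun k =>
    (integrableOn_mul_comp_sq_div_two hb (g := fun h => h ^ (n + k) * Real.exp (-h))
      ((integrableOn_pow_mul_exp_neg (n + k)).mono_set
        (Set.Ioi_subset_Ioi (by positivity)))).const_mul _
  have hval : ∀ k, ∫ t in Set.Ioi b, F k t =
      Real.exp (-(a ^ 2 / 2)) * (a ^ 2 / 2) ^ k / k.factorial *
        (gammaMeasure ((n + 1 + k : ℕ) : ℝ) 1).real (Set.Ioi (b ^ 2 / 2)) := fun k => by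
    rw [integral_const_mul, integral_mul_comp_sq_div_two hb (fun h => h ^ (n + k) * Real.exp (-h)),
      gammaMeasure_real_Ioi (by omega) (by positivity), upperGamma,
      show n + 1 + k = n + k + 1 by ring, Nat.add_sub_cancel, Nat.cast_succ (n + k),
      Real.Gamma_nat_eq_factorial]
    ring
  have hnn : ∀ k, ∀ t ∈ Set.Ioi b, 0 ≤ F k t := fun k t ht => by
    have : 0 ≤ t := hb.trans (le_of_lt ht)
    positivity
  have hsum := hasSum_noncentralGamma_real (m := n + 1) (by omega) hlam
    (measurableSet_Ioi (a := b ^ 2 / 2))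
  have hnorm : ∀ k, ∫ t in Set.Ioi b, ‖F k t‖ = ∫ t in Set.Ioi b, F k t := fun k =>
    setIntegral_congr_fun measurableSet_Ioi fun t ht => Real.norm_of_nonneg (hnn k t ht)
  simp_rw [hF]
  -- All terms are nonnegative, so the integrals of their norms are the terms of the convergent
  -- mixture series, which justifies exchanging sum and integral.
  refine HasSum.unique (hasSum_integral_of_summable_integral_norm hint ?_) ?_
  · simp_rw [hnorm, hval]
    exact hsum.summable
  · simp_rw [hval]
    exact hsum

/-- `phi` is the distribution function at `x / (1 - ρ²)` of the noncentral gamma distribution. -/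
theorem phi_eq_noncentralGamma_real {m : ℕ} (hm : 1 ≤ m) {ρ z x : ℝ} (hρ : |ρ| < 1) (hz : 0 ≤ z)
    (hx : 0 ≤ x) :
    phi m ρ z x =
      (noncentralGamma m (z * ρ ^ 2 / (1 - ρ ^ 2))).real (Set.Iic (x / (1 - ρ ^ 2))) := by
  have hρ' : 0 < 1 - ρ ^ 2 := by
    have := (sq_lt_one_iff_abs_lt_one ρ).mpr hρ
    linarith
  have := isProbabilityMeasure_noncentralGamma hm
    (show 0 ≤ z * ρ ^ 2 / (1 - ρ ^ 2) by positivity)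
  rw [phi, marcumQ_eq_noncentralGamma_real hm _ (Real.sqrt_nonneg _), Real.sq_sqrt (by positivity),
    Real.sq_sqrt (by positivity),
    show 2 * z * ρ ^ 2 / (1 - ρ ^ 2) / 2 = z * ρ ^ 2 / (1 - ρ ^ 2) by ring,
    show 2 * x / (1 - ρ ^ 2) / 2 = x / (1 - ρ ^ 2) by ring,
    ← Set.compl_Iic, probReal_compl_eq_one_sub measurableSet_Iic, sub_sub_cancel]

/-! ### The bound `|J₀| < 1` away from the origin. -/

/-- The Wallis product for the mean of `sin ^ (2 * k)`; its `(2 * k)!` cancels the denominator of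
the cosine series and leaves the coefficient of `J₀`. -/
theorem prod_range_odd_div_even (k : ℕ) :
    ∏ i ∈ Finset.range k, (2 * (i : ℝ) + 1) / (2 * i + 2) =
      ((2 * k).factorial : ℝ) / (4 ^ k * (k.factorial : ℝ) ^ 2) := by
  induction k with
  | zero => simp
  | succ k ih =>
    rw [Finset.prod_range_succ, ih, show 2 * (k + 1) = 2 * k + 1 + 1 by ring,
      Nat.factorial_succ, Nat.factorial_succ, Nat.factorial_succ k]
    push_cast
    field_simp
    ring

/-- Bessel's integral for `J₀`. -/
theorem pi_mul_besselJ_zero (x : ℝ) :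
    Real.pi * besselJ 0 x = ∫ θ in (0 : ℝ)..Real.pi, Real.cos (x * Real.sin θ) := by
  have h := intervalIntegral.hasSum_integral_of_dominated_convergence
    (μ := volume) (a := 0) (b := Real.pi)
    (F := fun (k : ℕ) (θ : ℝ) =>
      (-1) ^ k * (x * Real.sin θ) ^ (2 * k) / ((2 * k).factorial : ℝ))
    (f := fun θ => Real.cos (x * Real.sin θ))
    (fun k _ => |x| ^ (2 * k) / ((2 * k).factorial : ℝ))
    (fun k => by fun_prop)
    (fun k => ae_of_all _ fun θ _ => by
      rw [norm_div, norm_mul, norm_pow, norm_neg, norm_one, one_pow, one_mul, norm_pow, norm_mul,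
        Real.norm_eq_abs, Real.norm_eq_abs, Real.norm_natCast]
      gcongr
      exact mul_le_of_le_one_right (abs_nonneg _) (Real.abs_sin_le_one θ))
    (ae_of_all _ fun θ _ => (Real.hasSum_cosh |x|).summable)
    intervalIntegrable_const
    (ae_of_all _ fun θ _ => Real.hasSum_cos _)
  rw [← h.tsum_eq, besselJ, ← tsum_mul_left]
  refine tsum_congr fun k => ?_
  have hterm : ∀ θ : ℝ, (-1) ^ k * (x * Real.sin θ) ^ (2 * k) / ((2 * k).factorial : ℝ) =
      (-1) ^ k * x ^ (2 * k) / ((2 * k).factorial : ℝ) * Real.sin θ ^ (2 * k) := fun θ => by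
    rw [mul_pow]; ring
  simp_rw [hterm]
  rw [intervalIntegral.integral_const_mul, integral_sin_pow_even, prod_range_odd_div_even,
    add_zero, add_zero, div_pow, pow_mul 2 2 k]
  norm_num
  field_simp

theorem abs_besselJ_zero_lt_one {x : ℝ} (hx : 0 < x) : |besselJ 0 x| < 1 := by
  have hcont : Continuous fun θ => Real.cos (x * Real.sin θ) := by fun_prop
  have hpi := Real.pi_pos
  have hupper : ∫ θ in (0 : ℝ)..Real.pi, Real.cos (x * Real.sin θ) <
      ∫ _ in (0 : ℝ)..Real.pi, (1 : ℝ) := by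
    refine intervalIntegral.integral_lt_integral_of_continuousOn_of_le_of_exists_lt hpi
      hcont.continuousOn continuousOn_const (fun θ _ => Real.cos_le_one _) ?_
    -- With `sin θ = min 1 (1 / x)` one has `0 < x * sin θ ≤ 1 < π`, so the cosine is strictly below
    -- `1` there.
    have hmin : 0 < min 1 (1 / x) := lt_min one_pos (by positivity)
    have hsin : Real.sin (Real.arcsin (min 1 (1 / x))) = min 1 (1 / x) :=
      Real.sin_arcsin (by linarith) (min_le_left _ _)
    refine ⟨Real.arcsin (min 1 (1 / x)), ⟨(Real.arcsin_pos.mpr hmin).le, ?_⟩, ?_⟩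
    · linarith [Real.arcsin_le_pi_div_two (min 1 (1 / x))]
    · rw [hsin]
      have h₁ : x * min 1 (1 / x) ≤ 1 :=
        (mul_le_mul_of_nonneg_left (min_le_right _ _) hx.le).trans (by field_simp; rfl)
      have h₂ := Real.cos_lt_cos_of_nonneg_of_le_pi le_rfl
        (h₁.trans (by linarith [Real.pi_gt_three])) (mul_pos hx hmin)
      rwa [Real.cos_zero] at h₂
  have hlower : ∫ _ in (0 : ℝ)..Real.pi, (-1 : ℝ) <
      ∫ θ in (0 : ℝ)..Real.pi, Real.cos (x * Real.sin θ) := by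
    refine intervalIntegral.integral_lt_integral_of_continuousOn_of_le_of_exists_lt hpi
      continuousOn_const hcont.continuousOn (fun θ _ => Real.neg_one_le_cos _)
      ⟨0, ⟨le_rfl, hpi.le⟩, by simp⟩
  rw [← pi_mul_besselJ_zero, intervalIntegral.integral_const, smul_eq_mul, sub_zero] at hupper hlower
  exact abs_lt.mpr ⟨lt_of_mul_lt_mul_left hlower hpi.le, lt_of_mul_lt_mul_left hupper hpi.le⟩

theorem abs_portCorrelation_lt_one {lam d : ℝ} (hlam : 0 < lam) (hd : 0 < d) :
    |portCorrelation lam d| < 1 :=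
  abs_besselJ_zero_lt_one (by positivity)

/-! ### One port conditioned on the reference port. -/

theorem pi_gaussianReal_sum_sq_le {ι : Type*} [Fintype ι] {m : ℕ} (hm : 1 ≤ m)
    (hι : Fintype.card ι = 2 * m) {ρ x : ℝ} (hρ : |ρ| < 1) (hx : 0 ≤ x) (u : ι → ℝ) :
    (Measure.pi fun _ : ι => gaussianReal 0 (1 / 2))
        {w | ∑ i, (√(1 - ρ ^ 2) * w i + ρ * u i) ^ 2 ≤ x} =
      ENNReal.ofReal (phi m ρ (∑ i, u i ^ 2) x) := by
  have hρ' : 0 < 1 - ρ ^ 2 := by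
    have := (sq_lt_one_iff_abs_lt_one ρ).mpr hρ
    linarith
  have hu : 0 ≤ ∑ i, u i ^ 2 := Finset.sum_nonneg fun i _ => sq_nonneg _
  have hs : 0 < √(1 - ρ ^ 2) := Real.sqrt_pos.mpr hρ'
  have hs2 : √(1 - ρ ^ 2) ^ 2 = 1 - ρ ^ 2 := Real.sq_sqrt hρ'.le
  have := isProbabilityMeasure_noncentralGamma hm
    (show 0 ≤ (∑ i, u i ^ 2) * ρ ^ 2 / (1 - ρ ^ 2) by positivity)
  have hlam : (∑ i, u i ^ 2) * ρ ^ 2 / (1 - ρ ^ 2) = ∑ i, (ρ / √(1 - ρ ^ 2) * u i) ^ 2 := by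
    simp_rw [mul_pow, div_pow, hs2]
    rw [← Finset.mul_sum]
    ring
  rw [phi_eq_noncentralGamma_real hm hρ hu hx, ofReal_measureReal, hlam,
    ← map_sum_sq_add_pi_gaussianReal hm hι, Measure.map_apply (by fun_prop) measurableSet_Iic]
  congr 1
  ext w
  simp only [Set.mem_ofPred_eq, Set.mem_preimage, Set.mem_Iic]
  have hsum : ∑ i, (√(1 - ρ ^ 2) * w i + ρ * u i) ^ 2 =
      (1 - ρ ^ 2) * ∑ i, (w i + ρ / √(1 - ρ ^ 2) * u i) ^ 2 := by
    rw [Finset.mul_sum]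
    refine Finset.sum_congr rfl fun i _ => ?_
    nth_rewrite 2 [← hs2]
    rw [← mul_pow]
    congr 1
    field_simp
  rw [hsum, le_div_iff₀' hρ']

theorem phi_nonneg {m : ℕ} (hm : 1 ≤ m) {ρ z x : ℝ} (hρ : |ρ| < 1) (hz : 0 ≤ z) (hx : 0 ≤ x) :
    0 ≤ phi m ρ z x := by
  rw [phi_eq_noncentralGamma_real hm hρ hz hx]
  exact measureReal_nonneg

/-- Measurability comes from Fubini: `phi` is the measure of the slices of a measurable set, taking
as reference vector one with a single nonzero coordinate `√|z|`, whose squared length is `|z|`. The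
absolute value extends the identity to all real `z`. -/
theorem measurable_phi_abs {m : ℕ} (hm : 1 ≤ m) {ρ x : ℝ} (hρ : |ρ| < 1) (hx : 0 ≤ x) :
    Measurable fun z => phi m ρ |z| x := by
  let i₀ : Fin (2 * m) := ⟨0, by omega⟩
  have hmeas : MeasurableSet {p : ℝ × (Fin (2 * m) → ℝ) |
      ∑ i, (√(1 - ρ ^ 2) * p.2 i + ρ * (Pi.single i₀ √|p.1| : Fin (2 * m) → ℝ) i) ^ 2 ≤ x} := by
    refine measurableSet_le (Finset.measurable_sum _ fun i _ => ?_) measurable_const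
    have : Measurable fun p : ℝ × (Fin (2 * m) → ℝ) =>
        (Pi.single i₀ √|p.1| : Fin (2 * m) → ℝ) i := by
      by_cases hi : i = i₀
      · subst hi
        simp only [Pi.single_eq_same]
        fun_prop
      · simp [Pi.single_eq_of_ne hi]
    fun_prop
  have h := (measurable_measure_prodMk_left
    (ν := Measure.pi fun _ : Fin (2 * m) => gaussianReal 0 (1 / 2)) hmeas).ennreal_toReal
  convert h using 1
  funext z
  have hsum : ∑ i, (Pi.single i₀ √|z| : Fin (2 * m) → ℝ) i ^ 2 = |z| := by
    rw [Finset.sum_eq_single i₀ (fun i _ hi => by simp [Pi.single_eq_of_ne hi]) (by simp),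
      Pi.single_eq_same, Real.sq_sqrt (abs_nonneg z)]
  change _ = ((Measure.pi fun _ : Fin (2 * m) => gaussianReal 0 (1 / 2)) {w |
    ∑ i, (√(1 - ρ ^ 2) * w i + ρ * (Pi.single i₀ √|z| : Fin (2 * m) → ℝ) i) ^ 2 ≤ x}).toReal
  rw [pi_gaussianReal_sum_sq_le hm (by simp) hρ hx, hsum,
    ENNReal.toReal_ofReal (phi_nonneg hm hρ (abs_nonneg z) hx)]

/-! ### Passage to Gaussian vectors and integration over the reference port. -/

/-- The gains of the ports as a function of the underlying real Gaussian vectors. -/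
def vectorGain {N : ℕ} [NeZero N] {ι : Type*} [Fintype ι] (ρ : Fin N → ℝ) (v : Fin N → ι → ℝ)
    (n : Fin N) : ℝ :=
  if n = 0 then ∑ i, v 0 i ^ 2 else ∑ i, (√(1 - ρ n ^ 2) * v n i + ρ n * v 0 i) ^ 2

theorem measurable_vectorGain {N : ℕ} [NeZero N] {ι : Type*} [Fintype ι] (ρ : Fin N → ℝ)
    (n : Fin N) : Measurable fun v : Fin N → ι → ℝ => vectorGain ρ v n := by
  unfold vectorGain
  split_ifs <;> fun_prop

theorem portGain_eq_vectorGain {Ω : Type*} {N m : ℕ} [NeZero N] (ρ : Fin N → ℝ)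
    (X Y : Fin N → Fin m → Ω → ℝ) (n : Fin N) (ω : Ω) :
    portGain ρ X Y n ω =
      vectorGain ρ (fun n => Sum.elim (fun k => X n k ω) (fun k => Y n k ω)) n := by
  have hnorm : ∀ a b : ℝ, ‖(a : ℂ) + Complex.I * (b : ℂ)‖ ^ 2 = a ^ 2 + b ^ 2 := fun a b => by
    rw [mul_comm, ← Complex.normSq_eq_norm_sq, Complex.normSq_add_mul_I]
  unfold portGain vectorGain channel
  split_ifs
  · simp only [hnorm, Fintype.sum_sum_type, Sum.elim_inl, Sum.elim_inr, Finset.sum_add_distrib]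
  · simp only [hnorm, Fintype.sum_sum_type, Sum.elim_inl, Sum.elim_inr, Finset.sum_add_distrib]

/-- The law of the underlying Gaussian vectors. -/
theorem hasLaw_gaussianVectors {Ω : Type*} [MeasurableSpace Ω] {P : Measure Ω} {N m : ℕ}
    {X Y : Fin N → Fin m → Ω → ℝ}
    (hX : ∀ n k, HasLaw (X n k) (gaussianReal 0 (1 / 2)) P)
    (hY : ∀ n k, HasLaw (Y n k) (gaussianReal 0 (1 / 2)) P)
    (hindep : iIndepFun
      (Sum.elim (fun p : Fin N × Fin m => X p.1 p.2) (fun p : Fin N × Fin m => Y p.1 p.2)) P) :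
    HasLaw (fun ω n => Sum.elim (fun k => X n k ω) (fun k => Y n k ω))
      (Measure.pi fun _ : Fin N => Measure.pi fun _ : Fin m ⊕ Fin m => gaussianReal 0 (1 / 2)) P := by
  let e : Fin N × (Fin m ⊕ Fin m) ≃ (Fin N × Fin m) ⊕ (Fin N × Fin m) :=
    Equiv.prodSumDistrib _ _ _
  have hlaw : ∀ p : Fin N × (Fin m ⊕ Fin m), HasLaw
      (Sum.elim (fun p : Fin N × Fin m => X p.1 p.2) (fun p : Fin N × Fin m => Y p.1 p.2) (e p))
      (gaussianReal 0 (1 / 2)) P := by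
    rintro ⟨n, k | k⟩
    · exact hX n k
    · exact hY n k
  have hjoint := (hindep.precomp e.injective).hasLaw_pi hlaw
  have hcurry : HasLaw (MeasurableEquiv.curry (Fin N) (Fin m ⊕ Fin m) ℝ)
      (Measure.pi fun _ : Fin N => Measure.pi fun _ : Fin m ⊕ Fin m => gaussianReal 0 (1 / 2))
      (Measure.pi fun _ : Fin N × (Fin m ⊕ Fin m) => gaussianReal 0 (1 / 2)) := by
    refine ⟨(MeasurableEquiv.measurable _).aemeasurable, ?_⟩
    have h := Measure.infinitePi_map_curry
      (fun (_ : Fin N) (_ : Fin m ⊕ Fin m) => gaussianReal 0 (1 / 2))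
    simpa only [Measure.infinitePi_eq_pi] using h
  refine (hcurry.comp hjoint).congr (ae_of_all _ fun ω => ?_)
  funext n k
  cases k <;> rfl

theorem cdf_map_bestGain {Ω : Type*} [MeasurableSpace Ω] {P : Measure Ω} [IsProbabilityMeasure P]
    {N m : ℕ} [NeZero N] {X Y : Fin N → Fin m → Ω → ℝ}
    (hX : ∀ n k, HasLaw (X n k) (gaussianReal 0 (1 / 2)) P)
    (hY : ∀ n k, HasLaw (Y n k) (gaussianReal 0 (1 / 2)) P)
    (hindep : iIndepFun
      (Sum.elim (fun p : Fin N × Fin m => X p.1 p.2) (fun p : Fin N × Fin m => Y p.1 p.2)) P)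
    (ρ : Fin N → ℝ) (x : ℝ) :
    cdf (P.map (bestGain ρ X Y)) x =
      (Measure.pi fun _ : Fin N => Measure.pi fun _ : Fin m ⊕ Fin m => gaussianReal 0 (1 / 2)).real
        {v | ∀ n, vectorGain ρ v n ≤ x} := by
  have hV := hasLaw_gaussianVectors hX hY hindep
  have hsup : Measurable fun v : Fin N → Fin m ⊕ Fin m → ℝ =>
      Finset.univ.sup' ⟨0, Finset.mem_univ _⟩ (vectorGain ρ v) := by
    have h := Finset.measurable_sup' (s := (Finset.univ : Finset (Fin N)))
      ⟨0, Finset.mem_univ _⟩ (f := fun n (v : Fin N → Fin m ⊕ Fin m → ℝ) => vectorGain ρ v n)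
      (fun n _ => measurable_vectorGain ρ n)
    convert h using 1
    funext v
    exact (Finset.sup'_apply (C := fun _ => ℝ) ⟨0, Finset.mem_univ _⟩
      (fun n (v : Fin N → Fin m ⊕ Fin m → ℝ) => vectorGain ρ v n) v).symm
  have hbest : bestGain ρ X Y = (fun v : Fin N → Fin m ⊕ Fin m → ℝ =>
      Finset.univ.sup' ⟨0, Finset.mem_univ _⟩ (vectorGain ρ v)) ∘
        fun ω n => Sum.elim (fun k => X n k ω) (fun k => Y n k ω) := by
    funext ω
    simp only [bestGain, Function.comp_apply, portGain_eq_vectorGain]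
  have hmeas : AEMeasurable (bestGain ρ X Y) P := by
    rw [hbest]
    exact hsup.comp_aemeasurable hV.aemeasurable
  have := Measure.isProbabilityMeasure_map hmeas
  rw [cdf_eq_real, hbest, ← AEMeasurable.map_map_of_aemeasurable hsup.aemeasurable hV.aemeasurable,
    hV.map_eq, map_measureReal_apply hsup measurableSet_Iic]
  congr 1
  ext v
  exact (Finset.sup'_le_iff ⟨(0 : Fin N), Finset.mem_univ _⟩ (vectorGain ρ v)).trans
    ⟨fun h n => h n (Finset.mem_univ n), fun h n _ => h n⟩

theorem pi_real_vectorGain_le {M m : ℕ} (hm : 1 ≤ m) {ι : Type*} [Fintype ι]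
    (hι : Fintype.card ι = 2 * m) {ρ : Fin (M + 1) → ℝ} (hρ : ∀ n, n ≠ 0 → |ρ n| < 1) {x : ℝ}
    (hx : 0 ≤ x) :
    (Measure.pi fun _ : Fin (M + 1) => Measure.pi fun _ : ι => gaussianReal 0 (1 / 2)).real
        {v | ∀ n, vectorGain ρ v n ≤ x} =
      1 / Real.Gamma m * ∫ z in (0 : ℝ)..x, Real.exp (-z) * z ^ (m - 1) *
        ∏ n ∈ Finset.univ.erase (0 : Fin (M + 1)), phi m (ρ n) z x := by
  set γ : Measure (ι → ℝ) := Measure.pi fun _ : ι => gaussianReal 0 (1 / 2)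
  have hm0 : (0 : ℝ) < m := by exact_mod_cast hm
  -- The indicator encodes the constraint that the reference gain is at most `x`; `|z|` is harmless
  -- because the gamma law lives on `[0, ∞)`.
  let H : ℝ → ℝ := (Set.Iic x).indicator fun z => ∏ n : Fin M, phi m (ρ n.succ) |z| x
  have hρs : ∀ n : Fin M, |ρ n.succ| < 1 := fun n => hρ _ (Fin.succ_ne_zero n)
  have hHmeas : Measurable H :=
    (Finset.measurable_prod _ fun n _ => measurable_phi_abs hm (hρs n) hx).indicator
      measurableSet_Iic
  have hHnn : ∀ z, 0 ≤ H z := Set.indicator_nonneg fun z _ =>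
    Finset.prod_nonneg fun n _ => phi_nonneg hm (hρs n) (abs_nonneg z) hx
  let S : Set ((ι → ℝ) × (Fin M → ι → ℝ)) := {p | ∑ i, p.1 i ^ 2 ≤ x ∧
    ∀ n, ∑ i, (√(1 - ρ n.succ ^ 2) * p.2 n i + ρ n.succ * p.1 i) ^ 2 ≤ x}
  have hS : MeasurableSet S := by
    simp only [S, Set.ofPred_and, Set.ofPred_forall]
    exact (measurableSet_le (by fun_prop) measurable_const).inter
      (MeasurableSet.iInter fun n => measurableSet_le (by fun_prop) measurable_const)
  have hpre : {v : Fin (M + 1) → ι → ℝ | ∀ n, vectorGain ρ v n ≤ x} =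
      MeasurableEquiv.piFinSuccAbove (fun _ => ι → ℝ) 0 ⁻¹' S := by
    ext v
    simp only [Set.mem_ofPred_eq, Fin.forall_fin_succ, Set.mem_preimage, S]
    simp [vectorGain, MeasurableEquiv.piFinSuccAbove, Fin.tail]
  -- For fixed `u` the slice is empty or a product set over the remaining ports; this is their
  -- conditional independence.
  have hslice : ∀ u : ι → ℝ, (Measure.pi fun _ : Fin M => γ) (Prod.mk u ⁻¹' S) =
      ENNReal.ofReal (H (∑ i, u i ^ 2)) := by
    intro u
    have hu : 0 ≤ ∑ i, u i ^ 2 := Finset.sum_nonneg fun i _ => sq_nonneg _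
    by_cases hux : ∑ i, u i ^ 2 ≤ x
    · have hset : Prod.mk u ⁻¹' S = Set.univ.pi fun n : Fin M =>
          {w : ι → ℝ | ∑ i, (√(1 - ρ n.succ ^ 2) * w i + ρ n.succ * u i) ^ 2 ≤ x} := by
        ext w
        simp [S, hux]
      simp only [H]
      rw [hset, Measure.pi_pi, Set.indicator_of_mem (Set.mem_Iic.mpr hux), abs_of_nonneg hu,
        ENNReal.ofReal_prod_of_nonneg fun n _ => phi_nonneg hm (hρs n) hu hx]
      exact Finset.prod_congr rfl fun n _ => pi_gaussianReal_sum_sq_le hm hι (hρs n) hx u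
    · have hset : Prod.mk u ⁻¹' S = ∅ := by
        ext w
        simp [S, hux]
      simp only [H]
      rw [hset, Set.indicator_of_notMem (by simpa using hux)]
      simp
  -- The zero-shift case gives the law of the reference gain.
  have hmap : γ.map (fun u => ∑ i, u i ^ 2) = gammaMeasure m 1 := by
    have h := map_sum_sq_add_pi_gaussianReal hm hι 0
    simpa only [Pi.zero_apply, add_zero, zero_pow two_ne_zero, Finset.sum_const_zero,
      noncentralGamma_zero m] using h
  have hprob : (Measure.pi fun _ : Fin (M + 1) => γ) {v | ∀ n, vectorGain ρ v n ≤ x} =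
      ∫⁻ z, ENNReal.ofReal (H z) ∂gammaMeasure m 1 := by
    rw [hpre, (measurePreserving_piFinSuccAbove (fun _ => γ) 0).measure_preimage
      hS.nullMeasurableSet, Measure.prod_apply hS, ← hmap,
      lintegral_map hHmeas.ennreal_ofReal (by fun_prop)]
    exact lintegral_congr hslice
  rw [measureReal_def, hprob, ← integral_eq_lintegral_of_nonneg_ae (ae_of_all _ hHnn)
      hHmeas.aestronglyMeasurable, gammaMeasure,
    integral_withDensity_eq_integral_toReal_smul (by unfold gammaPDF; fun_prop)
      (ae_of_all _ fun z => by simp [gammaPDF])]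
  have hsupp : ∀ z, z ∉ Set.Icc 0 x → (gammaPDF m 1 z).toReal • H z = 0 := by
    intro z hz
    rcases lt_or_ge z 0 with hz0 | hz0
    · rw [gammaPDF_of_neg hz0]
      simp
    · have hzx : z ∉ Set.Iic x := fun h => hz ⟨hz0, h⟩
      simp [H, Set.indicator_of_notMem hzx]
  rw [← setIntegral_eq_integral_of_forall_compl_eq_zero hsupp, integral_Icc_eq_integral_Ioc,
    intervalIntegral.integral_of_le hx, ← integral_const_mul]
  refine setIntegral_congr_fun measurableSet_Ioc fun z hz => ?_
  have hprod : ∏ n ∈ Finset.univ.erase (0 : Fin (M + 1)), phi m (ρ n) z x =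
      ∏ n : Fin M, phi m (ρ n.succ) z x := by
    rw [← Finset.compl_singleton, ← Fin.image_succ_univ,
      Finset.prod_image (Fin.succ_injective M).injOn]
  simp only [H]
  rw [gammaPDF, ENNReal.toReal_ofReal (gammaPDFReal_nonneg hm0 one_pos z),
    gammaPDFReal_natCast_one hm hz.1.le, Set.indicator_of_mem (Set.mem_Iic.mpr hz.2),
    abs_of_pos hz.1, hprod, smul_eq_mul]
  ring

/-- The distribution function of the best gain for arbitrary correlations in `(-1, 1)`. -/
theorem cdf_bestGain {Ω : Type*} [MeasurableSpace Ω] {P : Measure Ω} [IsProbabilityMeasure P]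
    {N m : ℕ} [NeZero N] (hm : 1 ≤ m) {X Y : Fin N → Fin m → Ω → ℝ}
    (hX : ∀ n k, HasLaw (X n k) (gaussianReal 0 (1 / 2)) P)
    (hY : ∀ n k, HasLaw (Y n k) (gaussianReal 0 (1 / 2)) P)
    (hindep : iIndepFun
      (Sum.elim (fun p : Fin N × Fin m => X p.1 p.2) (fun p : Fin N × Fin m => Y p.1 p.2)) P)
    {ρ : Fin N → ℝ} (hρ : ∀ n, n ≠ 0 → |ρ n| < 1) :
    (∀ x : ℝ, x < 0 → cdf (P.map (bestGain ρ X Y)) x = 0) ∧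
    (∀ x : ℝ, 0 ≤ x → cdf (P.map (bestGain ρ X Y)) x =
      1 / Real.Gamma m * ∫ z in (0 : ℝ)..x, Real.exp (-z) * z ^ (m - 1) *
        ∏ n ∈ Finset.univ.erase (0 : Fin N), phi m (ρ n) z x) := by
  constructor <;> intro x hx <;> rw [cdf_map_bestGain hX hY hindep]
  · have hempty : {v : Fin N → Fin m ⊕ Fin m → ℝ | ∀ n, vectorGain ρ v n ≤ x} = ∅ := by
      refine Set.eq_empty_of_forall_notMem fun v hv => ?_
      have h := hv 0
      rw [vectorGain, if_pos rfl] at h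
      have : 0 ≤ ∑ i, v 0 i ^ 2 := Finset.sum_nonneg fun i _ => sq_nonneg _
      linarith
    rw [hempty, measureReal_empty]
  · obtain ⟨M, rfl⟩ := Nat.exists_eq_succ_of_ne_zero (NeZero.ne N)
    exact pi_real_vectorGain_le hm (by simp [two_mul]) hρ hx

end

end FluidAntenna

theorem theorem1 {Ω : Type*} [MeasurableSpace Ω] (P : Measure Ω) [IsProbabilityMeasure P]
    (N m : ℕ) [NeZero N] (hm : 1 ≤ m)
    (X Y : Fin N → Fin m → Ω → ℝ)
    (hX : ∀ n k, HasLaw (X n k) (gaussianReal 0 (1 / 2)) P)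
    (hY : ∀ n k, HasLaw (Y n k) (gaussianReal 0 (1 / 2)) P)
    (hindep : iIndepFun
      (Sum.elim (fun p : Fin N × Fin m => X p.1 p.2) (fun p : Fin N × Fin m => Y p.1 p.2)) P) :
    (∀ ρ : Fin N → ℝ, (∀ n, n ≠ 0 → |ρ n| < 1) →
      (∀ x : ℝ, x < 0 → cdf (P.map (FluidAntenna.bestGain ρ X Y)) x = 0) ∧
      (∀ x : ℝ, 0 ≤ x → cdf (P.map (FluidAntenna.bestGain ρ X Y)) x =
        1 / Real.Gamma m * ∫ z in (0 : ℝ)..x, Real.exp (-z) * z ^ (m - 1) *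
          ∏ n ∈ Finset.univ.erase (0 : Fin N), FluidAntenna.phi m (ρ n) z x)) ∧
    (∀ (lam : ℝ) (d ρ : Fin N → ℝ), 0 < lam → (∀ n, n ≠ 0 → 0 < d n) →
      (∀ n, ρ n = FluidAntenna.portCorrelation lam (d n)) →
      (∀ n, n ≠ 0 → |ρ n| < 1) ∧
      (∀ x : ℝ, x < 0 → cdf (P.map (FluidAntenna.bestGain ρ X Y)) x = 0) ∧
      (∀ x : ℝ, 0 ≤ x → cdf (P.map (FluidAntenna.bestGain ρ X Y)) x =
        1 / Real.Gamma m * ∫ z in (0 : ℝ)..x, Real.exp (-z) * z ^ (m - 1) *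
          ∏ n ∈ Finset.univ.erase (0 : Fin N), FluidAntenna.phi m (ρ n) z x)) := by
  refine ⟨fun ρ hρ => FluidAntenna.cdf_bestGain hm hX hY hindep hρ,
    fun lam d ρ hlam hd hρ => ?_⟩
  have hlt : ∀ n, n ≠ 0 → |ρ n| < 1 := fun n hn => by
    rw [hρ n]
    exact FluidAntenna.abs_portCorrelation_lt_one hlam (hd n hn)
  exact ⟨hlt, FluidAntenna.cdf_bestGain hm hX hY hindep hlt⟩
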